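/- **Setting.** Let $S$ be a commutative Hausdorff topological semigroup with a nonzero positive Radon measure $\mu$ on its Borel sets ($\mu(B)=\sup\{\mu(C): C\subset B \text{ compact}\}$ for Borel $B$, and every point has a neighbourhood of finite measure) which is invariant: $\mu(sB)=\mu(B)$ whenever $s\in S$ and $B$, $sB$ are Borel. Let $G$ be the group of fractions of $S$, $\tau:S\to G$ the canonical homomorphism, $G$ carrying the finest group topology that makes $\tau$ continuous. (If $\tau_1:S\to G_1$ is a homomorphism into a commutative topological group whose restriction to some nonempty ideal $S_0$ of $S$ is a topological embedding, with $\tau_1(S_0)$ open in $G_1$ and generating $G_1$, then $(G_1,\tau_1)$ is isomorphic to $(G,\tau)$.) Assume that $\Sigma=\tau(S)$ is a Borel subset of $G$. A *weight* on a topological semigroup is a nonnegative Borel measurable, locally bounded function $w$ with $w(st)\le w(s)w(t)$. Let $w$ be an everywhere positive weight on $S$ of the form $w=w'\circ\tau$, where $w'$ is a weight on $\Sigma$. Measurable functions on $S$ are identified when they agree $\mu$-almost everywhere. A function $F$ on $S$ is *factorizable* if $F=F'\circ\tau$ $\mu$-a.e. for some measurable $F':\Sigma\to\mathbb C$; $F'$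 is extended by zero to $G\setminus\Sigma$. For such $F$ and $k:S\to\mathbb C$ put $$F_s(t)=F'(\tau(s)^{-1}\tau(t)),\qquad (F*k)(t)=\int_S F_s(t)\,k(s)\,d\mu(s),$$ where the integral is required to converge absolutely. We write $f\to 0$ at $\infty$ if for every $\varepsilon>0$ there is a compact $K\subset S$ such that $|f(x)|<\varepsilon$ for $\mu$-almost all $x\in S\setminus K$. **Theorem 2.** Let $F$ be a ($\mu$-a.e.) measurable complex function on $S$ with $Fw\in L^\infty(S,\mu)$, let $k\in L^1(w)=L^1(S,w\mu)$, and suppose that $Fw\to 0$ at $\infty$. Then $F$ is factorizable, and for every choice of $F'$ the convolution $(F*k)(t)$ exists for every $t\in S$ and $(F*k)w\to 0$ at $\infty$. If moreover $S$ is cancellative, then for every $\varepsilon>0$ there is a compact $K\subset S$ such that $|(F*k)(t)|\,w(t)<\varepsilon$ for every $t\in S\setminus K$. -/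

import Mathlib

open MeasureTheory Topology Filter

/-- A positive measure `μ` on the Borel sets of a semigroup is invariant if `μ (sB) = μ B` for every
`s` and every Borel set `B` such that `sB` is a Borel set. -/
def IsSemigroupInvariant {S : Type*} [Mul S] [MeasurableSpace S] (μ : Measure S) : Prop :=
  ∀ (s : S) (B : Set S), MeasurableSet B → MeasurableSet ((fun x => s * x) '' B) →
    μ ((fun x => s * x) '' B) = μ B

/-! ### The group of a commutative topological semigroup and the canonical homomorphism -/

/-- The group of fractions of a commutative semigroup `S` (the Grothendieck group of `S` with a unit
adjoined): the elements are formal fractions `a / b`. -/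
def FracGroup (S : Type*) [CommSemigroup S] : Type _ := Algebra.GrothendieckGroup (WithOne S)

noncomputable instance FracGroup.instCommGroup (S : Type*) [CommSemigroup S] :
    CommGroup (FracGroup S) :=
  inferInstanceAs (CommGroup (Algebra.GrothendieckGroup (WithOne S)))

/-- The canonical homomorphism `τ : S → G` of `S` into its group `G`. -/
noncomputable def tau (S : Type*) [CommSemigroup S] : S →ₙ* FracGroup S where
  toFun s := (Algebra.GrothendieckGroup.of (s : WithOne S) : Algebra.GrothendieckGroup (WithOne S))
  map_mul' s t := by
    rw [WithOne.coe_mul, map_mul]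
    rfl

/-- The topology of `G`: the finest group topology for which `τ : S → G` is continuous. -/
noncomputable instance FracGroup.instTopologicalSpace (S : Type*) [CommSemigroup S]
    [TopologicalSpace S] : TopologicalSpace (FracGroup S) :=
  (GroupTopology.coinduced (tau S)).toTopologicalSpace

instance FracGroup.instIsTopologicalGroup (S : Type*) [CommSemigroup S] [TopologicalSpace S] :
    IsTopologicalGroup (FracGroup S) :=
  (GroupTopology.coinduced (tau S)).toIsTopologicalGroup

/-- `G` carries its Borel σ-algebra. -/
noncomputable instance FracGroup.instMeasurableSpace (S : Type*) [CommSemigroup S]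
    [TopologicalSpace S] : MeasurableSpace (FracGroup S) := borel _

instance FracGroup.instBorelSpace (S : Type*) [CommSemigroup S] [TopologicalSpace S] :
    BorelSpace (FracGroup S) := ⟨rfl⟩

theorem continuous_tau (S : Type*) [CommSemigroup S] [TopologicalSpace S] : Continuous (tau S) :=
  GroupTopology.coinduced_continuous (tau S)

theorem fracGroup_exists_div {S : Type*} [CommSemigroup S] (u : S) (x : FracGroup S) :
    ∃ a b : WithOne S, ∀ p q : S, a * (u : WithOne S) = p → b * (u : WithOne S) = q →
      x = tau S p / tau S q := by
  induction x using Localization.ind with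
  | _ y =>
    obtain ⟨a, b, hb⟩ := y
    refine ⟨a, b, fun p q hp hq => ?_⟩
    have h1 : (Localization.mk a ⟨b, hb⟩ : Algebra.GrothendieckGroup (WithOne S))
        = Algebra.GrothendieckGroup.of a / Algebra.GrothendieckGroup.of b := by
      simp only [Algebra.GrothendieckGroup.of, Submonoid.LocalizationMap.toMonoidHom_apply]
      rw [← Localization.mk_one_eq_monoidOf_mk, ← Localization.mk_one_eq_monoidOf_mk,
        Algebra.GrothendieckGroup.mk_div_mk]
      simp
    change (Localization.mk a ⟨b, hb⟩ : Algebra.GrothendieckGroup (WithOne S))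
      = Algebra.GrothendieckGroup.of (p : WithOne S) / Algebra.GrothendieckGroup.of (q : WithOne S)
    rw [h1, ← hp, ← hq, map_mul, map_mul, mul_div_mul_right_eq_div]

/-- The pair `(G, τ)` is the only one, up to an isomorphism of topological groups over `S`, with the
following two properties: the restriction of `τ` to some ideal `S₀` of `S` is a topological
embedding, and `τ(S₀)` is open in `G` and generates `G`. -/
theorem fracGroup_unique {S : Type*} [CommSemigroup S] [TopologicalSpace S] [ContinuousMul S]
    {G' : Type*} [CommGroup G'] [TopologicalSpace G'] [IsTopologicalGroup G'] (τ' : S →ₙ* G')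
    (S₀ : Set S) (hne : S₀.Nonempty) (hideal : ∀ s : S, ∀ x ∈ S₀, s * x ∈ S₀)
    (hemb : IsEmbedding (fun x : S₀ => τ' x)) (hopen : IsOpen (τ' '' S₀))
    (hgen : Subgroup.closure (τ' '' S₀) = ⊤) :
    ∃ e : FracGroup S ≃ₜ* G', ∀ s : S, e (tau S s) = τ' s := by
  classical
  obtain ⟨u, hu⟩ := hne
  have hτ' : Continuous τ' := by
    have h1 : Continuous fun s : S => (⟨s * u, hideal s u hu⟩ : S₀) := by fun_prop
    have h2 : Continuous fun s : S => τ' (s * u) * (τ' u)⁻¹ :=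
      (hemb.continuous.comp h1).mul continuous_const
    convert h2 using 2 with s
    rw [map_mul, mul_inv_cancel_right]
  let φ : FracGroup S →* G' := Algebra.GrothendieckGroup.lift (WithOne.lift τ')
  have hφ : ∀ s, φ (tau S s) = τ' s := by
    intro s
    change (Algebra.GrothendieckGroup.lift (WithOne.lift τ'))
      (Algebra.GrothendieckGroup.of (s : WithOne S)) = _
    have := Algebra.GrothendieckGroup.lift.symm_apply_apply (WithOne.lift τ')
    rw [Algebra.GrothendieckGroup.lift_symm_apply] at this
    exact (DFunLike.congr_fun this (s : WithOne S)).trans (WithOne.lift_coe τ' s)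
  have hmem : ∀ a : WithOne S, ∃ p : S, p ∈ S₀ ∧ a * (u : WithOne S) = p := by
    intro a
    refine WithOne.cases_on a ⟨u, hu, one_mul _⟩ fun a => ⟨a * u, hideal a u hu, rfl⟩
  have hinj : Function.Injective φ := by
    rw [injective_iff_map_eq_one]
    intro x hx
    obtain ⟨a, b, hab⟩ := fracGroup_exists_div u x
    obtain ⟨p, hp, hp'⟩ := hmem a
    obtain ⟨q, hq, hq'⟩ := hmem b
    have hxe := hab p q hp' hq'
    rw [hxe, map_div, hφ, hφ, div_eq_one] at hx
    have hpq : (⟨p, hp⟩ : S₀) = ⟨q, hq⟩ := hemb.injective hx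
    have hpq' : p = q := congrArg Subtype.val hpq
    rw [hxe, hpq', div_self']
  have hsurj : Function.Surjective φ := by
    rw [← MonoidHom.range_eq_top, eq_top_iff, ← hgen, Subgroup.closure_le]
    rintro _ ⟨s, -, rfl⟩
    exact ⟨tau S s, hφ s⟩
  have hcont : Continuous φ := by
    let T : GroupTopology (FracGroup S) :=
      { toTopologicalSpace := TopologicalSpace.induced φ inferInstance
        toIsTopologicalGroup := topologicalGroup_induced φ }
    have hT : TopologicalSpace.coinduced (tau S) inferInstance ≤ T.toTopologicalSpace := by
      rw [← continuous_iff_coinduced_le]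
      refine continuous_induced_rng.2 ?_
      have : (φ ∘ tau S : S → G') = τ' := funext hφ
      rw [this]
      exact hτ'
    have hle : GroupTopology.coinduced (tau S) ≤ T := sInf_le hT
    exact continuous_iff_le_induced.2 hle
  let e : FracGroup S ≃* G' := MulEquiv.ofBijective φ ⟨hinj, hsurj⟩
  have he : ∀ s, e (tau S s) = τ' s := hφ
  have hoe : IsOpenEmbedding (fun x : S₀ => τ' x) := by
    refine ⟨hemb, ?_⟩
    have : Set.range (fun x : S₀ => τ' x) = τ' '' S₀ := by
      ext y
      simp
    rw [this]
    exact hopen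
  have hat : ContinuousAt e.symm (τ' u) := by
    refine (hoe.continuousAt_iff (x := ⟨u, hu⟩) (g := e.symm)).1 ?_
    have : (e.symm ∘ fun x : S₀ => τ' x) = fun x : S₀ => tau S x := by
      funext x
      simp [← he]
    rw [this]
    exact ((continuous_tau S).comp continuous_subtype_val).continuousAt
  have hsymm : Continuous e.symm := by
    refine continuous_of_continuousAt_one e.symm.toMonoidHom ?_
    have h1 : ContinuousAt (fun y : G' => e.symm (y * τ' u) * (e.symm (τ' u))⁻¹) 1 := by
      refine ContinuousAt.mul ?_ continuousAt_const
      refine ContinuousAt.comp (g := e.symm) (f := fun y => y * τ' u) ?_ (by fun_prop)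
      rw [one_mul]
      exact hat
    convert h1 using 2 with y
    simp
  exact ⟨{ e with continuous_toFun := hcont, continuous_invFun := hsymm }, he⟩

/-- The subsemigroup `Σ = τ(S)` of `G`. It carries the topology and the σ-algebra induced from `G`. -/
noncomputable abbrev tauRange (S : Type*) [CommSemigroup S] : Subsemigroup (FracGroup S) :=
  (tau S).srange

/-! ### Weights -/

/-- A weight on a semigroup: a nonnegative, measurable, locally bounded, submultiplicative
function. -/
structure IsWeight {S : Type*} [Mul S] [TopologicalSpace S] [MeasurableSpace S] (w : S → ℝ) :
    Prop where
  nonneg : ∀ s, 0 ≤ w s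
  measurable : Measurable w
  locallyBounded : ∀ s, ∃ U ∈ 𝓝 s, ∃ M : ℝ, ∀ x ∈ U, w x ≤ M
  submul : ∀ s t, w (s * t) ≤ w s * w t

/-- The weight `w` on `S` is factorizable: `w = w' ∘ τ` for a weight `w'` on `Σ = τ(S)`. -/
def IsFactorizableWeight {S : Type*} [CommSemigroup S] [TopologicalSpace S] (w : S → ℝ) : Prop :=
  ∃ w' : tauRange S → ℝ, IsWeight w' ∧ ∀ s, w s = w' ((tau S).srangeRestrict s)

/-- `k ∈ L¹(w) = L¹(S, wμ)`. -/
def MemL1Weight {S : Type*} [MeasurableSpace S] (μ : Measure S) (w : S → ℝ) (k : S → ℂ) : Prop :=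
  Integrable k (μ.withDensity fun s => ENNReal.ofReal (w s))

/-! ### Factorization, shifts, convolution, limits at infinity -/

/-- `F = F' ∘ τ` (as classes of functions modulo equality `μ`-almost everywhere), where `F'` is a
measurable function on `Σ = τ(S)`. -/
def IsFactorization {S : Type*} [CommSemigroup S] [TopologicalSpace S] [MeasurableSpace S]
    (μ : Measure S) (F : S → ℂ) (F' : tauRange S → ℂ) : Prop :=
  Measurable F' ∧ F =ᵐ[μ] fun s => F' ((tau S).srangeRestrict s)

/-- The extension by zero to `G` of a function on `Σ = τ(S)`. -/
noncomputable def zeroExtend {S : Type*} [CommSemigroup S] (F' : tauRange S → ℂ) :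
    FracGroup S → ℂ :=
  Function.extend Subtype.val F' 0

/-- The shift `F_s(t) = F'(τ(s)⁻¹ τ(t))` of `F = F' ∘ τ`, where `F'` vanishes off `Σ`. -/
noncomputable def semigroupShift {S : Type*} [CommSemigroup S] (F' : tauRange S → ℂ) (s t : S) : ℂ :=
  zeroExtend F' ((tau S s)⁻¹ * tau S t)

/-- The integral defining `(F ∗ k)(t)`, where `F = F' ∘ τ`, converges (absolutely). -/
def ConvExistsAt {S : Type*} [CommSemigroup S] [MeasurableSpace S] (μ : Measure S)
    (F' : tauRange S → ℂ) (k : S → ℂ) (t : S) : Prop :=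
  Integrable (fun s => semigroupShift F' s t * k s) μ

/-- The convolution `(F ∗ k)(t) = ∫ F_s(t) k(s) dμ(s)`, where `F = F' ∘ τ`. -/
noncomputable def semigroupConv {S : Type*} [CommSemigroup S] [MeasurableSpace S] (μ : Measure S)
    (F' : tauRange S → ℂ) (k : S → ℂ) (t : S) : ℂ :=
  ∫ s, semigroupShift F' s t * k s ∂μ

/-- `f → c` at infinity, for (classes of) functions that are defined `μ`-almost everywhere: for every
`ε > 0` the inequality `|f - c| < ε` holds (almost everywhere) outside some compact set. -/
def TendsAtInfty {S : Type*} [TopologicalSpace S] [MeasurableSpace S] (μ : Measure S)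
    (f : S → ℂ) (c : ℂ) : Prop :=
  ∀ ε : ℝ, 0 < ε → ∃ K : Set S, IsCompact K ∧ ∀ᵐ x ∂μ, x ∉ K → ‖f x - c‖ < ε

/-- `f → c` at infinity, for functions defined everywhere: for every `ε > 0` the inequality
`|f - c| < ε` holds at every point outside some compact set. -/
def TendsAtInftyEverywhere {S : Type*} [TopologicalSpace S] (f : S → ℂ) (c : ℂ) : Prop :=
  ∀ ε : ℝ, 0 < ε → ∃ K : Set S, IsCompact K ∧ ∀ x, x ∉ K → ‖f x - c‖ < ε

/-! Invariance makes `τ` almost injective. If `τ(x) = τ(y)`, then `ux = uy` for some `u`, so `μ(xK ∪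
yK) = μ(K)` for every compact `K`. Were `xk ≠ yk` at a support point `k`, a compact `K` of positive
measure near `k` would have disjoint translates and total measure `2μ(K)`. Hence `xk = yk`
(`mul_eq_mul_of_tau_eq`).

Three facts follow. The group `G` is Hausdorff, because the functions `τ(a)/τ(b) ↦ μ(aK ∪ bK) -
μ(K)` are continuous seminorms that separate points. For compact `A`, the saturation of `A` under
`τ` exceeds `A` by a null set, which gives factorization on σ-compact sets; `F` vanishes a.e. off
such a set. Finally, `s ↦ τ(s)⁻¹τ(t)` pulls null subsets of `τ(S)` back to null sets
(`measure_preimage_div_eq_zero`), so a.e. bounds on `Fw` pass to the shifts.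

Submultiplicativity then bounds `|F_s(t) k(s)| w(t)` by `|F'w'|(τ(s)⁻¹τ(t)) · |k(s)| w(s)`. Most of
the mass of `|k|w` lies on a compact `L`, and `|Fw|` is small off a compact `K`, so the convolution
is small when `τ(t) ∉ τ(LK)`. -/

/-! ### Fibres of the canonical homomorphism and translates of compact sets -/

theorem exists_mul_eq_mul_of_tau_eq {S : Type*} [CommSemigroup S] {x y : S}
    (h : tau S x = tau S y) : ∃ u : S, u * x = u * y := by
  have h' : (Localization.mk (x : WithOne S) (1 : (⊤ : Submonoid (WithOne S)))) =
      Localization.mk (y : WithOne S) 1 := by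
    rw [Localization.mk_one_eq_monoidOf_mk, Localization.mk_one_eq_monoidOf_mk]
    exact h
  rw [Localization.mk_eq_mk_iff, Localization.r_iff_exists] at h'
  obtain ⟨⟨c, _⟩, hc⟩ := h'
  simp only [OneMemClass.coe_one, one_mul] at hc
  revert hc
  refine WithOne.cases_on c (fun hc => ?_) (fun u hc => ⟨u, by exact_mod_cast hc⟩)
  rw [one_mul, one_mul, WithOne.coe_inj] at hc
  exact ⟨x, by rw [hc]⟩

theorem tau_eq_of_mul_eq_mul {S : Type*} [CommSemigroup S] {u x y : S} (h : u * x = u * y) :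
    tau S x = tau S y := by
  have := congrArg (tau S) h
  rwa [map_mul, map_mul, mul_right_inj] at this

theorem exists_eq_tau_div_tau {S : Type*} [CommSemigroup S] (u : S) (g : FracGroup S) :
    ∃ p q : S, g = tau S p / tau S q := by
  obtain ⟨a, b, hab⟩ := fracGroup_exists_div u g
  have hmem : ∀ a : WithOne S, ∃ p : S, a * (u : WithOne S) = p := fun a =>
    WithOne.cases_on a ⟨u, one_mul _⟩ fun a => ⟨a * u, rfl⟩
  obtain ⟨p, hp⟩ := hmem a
  obtain ⟨q, hq⟩ := hmem b
  exact ⟨p, q, hab p q hp hq⟩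

theorem image_mul_image_mul {S : Type*} [Semigroup S] (u s : S) (K : Set S) :
    (u * ·) '' ((s * ·) '' K) = ((u * s) * ·) '' K := by
  simp [Set.image_image, mul_assoc]

theorem IsCompact.image_mul_left {S : Type*} [Mul S] [TopologicalSpace S] [ContinuousMul S]
    {K : Set S} (hK : IsCompact K) (s : S) : IsCompact ((s * ·) '' K) :=
  hK.image (continuous_const_mul s)

theorem exists_isCompact_subset_measure_pos {X : Type*} [TopologicalSpace X] [MeasurableSpace X]
    [BorelSpace X] {μ : Measure X} [μ.InnerRegular] {k : X} (hk : k ∈ μ.support)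
    {U : Set X} (hU : IsOpen U) (hkU : k ∈ U) : ∃ K ⊆ U, IsCompact K ∧ 0 < μ K :=
  hU.measurableSet.exists_lt_isCompact
    ((Measure.mem_support_iff_forall k).1 hk U (hU.mem_nhds hkU))

theorem exists_mem_support {X : Type*} [TopologicalSpace X] [MeasurableSpace X]
    {μ : Measure X} [μ.InnerRegular] (hμ0 : μ ≠ 0) : ∃ k, k ∈ μ.support := by
  obtain ⟨K, hK, hK0⟩ := Measure.InnerRegular.exists_isCompact_not_null.2 hμ0
  by_contra! h
  refine hK0 (hK.measure_zero_of_nhdsWithin fun x _ => ?_)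
  have hx := h x
  rw [Measure.mem_support_iff_forall] at hx
  push Not at hx
  obtain ⟨U, hU, hU0⟩ := hx
  exact ⟨U, mem_nhdsWithin_of_mem_nhds hU, le_antisymm hU0 bot_le⟩

/-- The union of `A ∪ B` and `B ∪ C` contains `A ∪ C`, and their intersection contains `B`. This is
the source of the triangle inequality for the seminorms on `G`. -/
theorem measure_union_add_le {X : Type*} [MeasurableSpace X] {μ : Measure X}
    {A B C : Set X} (hA : MeasurableSet A) (hB : MeasurableSet B) :
    μ (A ∪ C) + μ B ≤ μ (A ∪ B) + μ (B ∪ C) := by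
  rw [← measure_union_add_inter' (hA.union hB) (B ∪ C)]
  refine add_le_add (measure_mono ?_) (measure_mono ?_)
  · exact Set.union_subset (Set.subset_union_left.trans Set.subset_union_left)
      (Set.subset_union_right.trans Set.subset_union_right)
  · exact Set.subset_inter Set.subset_union_right Set.subset_union_left

theorem IsSemigroupInvariant.measure_preimage {S : Type*} [CommSemigroup S] [TopologicalSpace S]
    [ContinuousMul S] [MeasurableSpace S] [BorelSpace S] {μ : Measure S}
    (hμ : IsSemigroupInvariant μ) (s : S) {C : Set S} (hC : MeasurableSet C)
    (hsub : C ⊆ Set.range (s * ·)) : μ ((s * ·) ⁻¹' C) = μ C := by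
  have h := hμ s ((s * ·) ⁻¹' C) (hC.preimage (continuous_const_mul s).measurable)
  rw [Set.image_preimage_eq_of_subset hsub] at h
  exact (h hC).symm

section Invariant

variable {S : Type*} [CommSemigroup S] [TopologicalSpace S] [T2Space S] [ContinuousMul S]
  [MeasurableSpace S] [BorelSpace S] {μ : Measure S}

theorem IsSemigroupInvariant.measure_image (hμ : IsSemigroupInvariant μ) (s : S) {C : Set S}
    (hC : IsCompact C) : μ ((s * ·) '' C) = μ C :=
  hμ s C hC.measurableSet (hC.image_mul_left s).measurableSet

theorem IsSemigroupInvariant.measure_image_union (hμ : IsSemigroupInvariant μ) (u a b : S)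
    {K : Set S} (hK : IsCompact K) :
    μ (((u * a) * ·) '' K ∪ ((u * b) * ·) '' K) = μ ((a * ·) '' K ∪ (b * ·) '' K) := by
  rw [← image_mul_image_mul, ← image_mul_image_mul, ← Set.image_union,
    hμ.measure_image u ((hK.image_mul_left a).union (hK.image_mul_left b))]

/-- If the translates by `x` and `y` of every compact set overlap up to null sets, then `x` and `y`
act equally on the support of the measure. -/
theorem mul_eq_mul_of_measure_union_le [μ.InnerRegular] [IsLocallyFiniteMeasure μ]
    (hμ : IsSemigroupInvariant μ) {x y k : S} (hk : k ∈ μ.support)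
    (h : ∀ K, IsCompact K → μ ((x * ·) '' K ∪ (y * ·) '' K) ≤ μ K) : x * k = y * k := by
  by_contra hne
  obtain ⟨A, B, hA, hB, hxA, hyB, hAB⟩ := t2_separation hne
  obtain ⟨K, hKU, hK, hK0⟩ := exists_isCompact_subset_measure_pos hk
    ((hA.preimage (continuous_const_mul x)).inter (hB.preimage (continuous_const_mul y)))
    ⟨hxA, hyB⟩
  have hdisj : Disjoint ((x * ·) '' K) ((y * ·) '' K) :=
    hAB.mono (Set.image_subset_iff.2 fun z hz => (hKU hz).1)
      (Set.image_subset_iff.2 fun z hz => (hKU hz).2)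
  have h1 := h K hK
  rw [measure_union hdisj (hK.image_mul_left y).measurableSet, hμ.measure_image x hK,
    hμ.measure_image y hK] at h1
  have h2 : μ K < μ K + μ K := ENNReal.lt_add_right hK.measure_lt_top.ne hK0.ne'
  exact absurd h1 h2.not_ge

theorem mul_eq_mul_of_tau_eq [μ.InnerRegular] [IsLocallyFiniteMeasure μ]
    (hμ : IsSemigroupInvariant μ) {x y k : S} (hk : k ∈ μ.support) (h : tau S x = tau S y) :
    x * k = y * k := by
  obtain ⟨u, hu⟩ := exists_mul_eq_mul_of_tau_eq h
  refine mul_eq_mul_of_measure_union_le hμ hk fun K hK => ?_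
  rw [← hμ.measure_image_union u x y hK, hu, Set.union_self, hμ.measure_image _ hK]

/-! ### Separation of the group of fractions -/

/-- Equality of fractions gives only `adk = cbk` with `k` in the support. Translating the two unions
by `kd` and `kb` turns them into the same set. -/
theorem measure_image_union_eq_of_tau_div_eq [μ.InnerRegular] [IsLocallyFiniteMeasure μ]
    (hμ0 : μ ≠ 0) (hμ : IsSemigroupInvariant μ) {a b c d : S}
    (h : tau S a / tau S b = tau S c / tau S d) {K : Set S} (hK : IsCompact K) :
    μ ((a * ·) '' K ∪ (b * ·) '' K) = μ ((c * ·) '' K ∪ (d * ·) '' K) := by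
  obtain ⟨k, hk⟩ := exists_mem_support hμ0
  have h1 : (a * d) * k = (c * b) * k := by
    refine mul_eq_mul_of_tau_eq hμ hk ?_
    rwa [map_mul, map_mul, ← div_eq_div_iff_mul_eq_mul]
  rw [← hμ.measure_image_union (k * d) a b hK, ← hμ.measure_image_union (k * b) c d hK]
  have h2 : k * d * a = k * b * c := by
    calc k * d * a = a * d * k := by ac_rfl
      _ = c * b * k := h1
      _ = k * b * c := by ac_rfl
  have h3 : k * d * b = k * b * d := by ac_rfl
  rw [h2, h3]

/-- The compact set `tK` has an open neighbourhood of measure below `r`, and it contains `sK` for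
all `s` near `t`. -/
theorem eventually_measure_image_union_lt [μ.InnerRegular] [IsLocallyFiniteMeasure μ]
    (hμ : IsSemigroupInvariant μ) {K : Set S} (hK : IsCompact K) (t : S) {r : ENNReal}
    (hr : μ K < r) : ∀ᶠ s in 𝓝 t, μ ((s * ·) '' K ∪ (t * ·) '' K) < r := by
  rw [← hμ.measure_image t hK] at hr
  obtain ⟨V, hKV, hV, hVr⟩ := (hK.image_mul_left t).exists_isOpen_lt_of_lt r hr
  have h : ∀ᶠ s in 𝓝 t, ∀ x ∈ K, s * x ∈ V :=
    hK.eventually_forall_of_forall_eventually fun x hx => by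
      have hc : Continuous fun z : S × S => z.1 * z.2 := continuous_mul
      exact hc.continuousAt.eventually (hV.mem_nhds (hKV ⟨x, hx, rfl⟩))
  filter_upwards [h] with s hs
  refine (measure_mono (Set.union_subset ?_ hKV)).trans_lt hVr
  exact Set.image_subset_iff.2 hs

theorem exists_groupSeminorm_measure_union [μ.InnerRegular] [IsLocallyFiniteMeasure μ]
    (hμ0 : μ ≠ 0) (hμ : IsSemigroupInvariant μ) {K : Set S} (hK : IsCompact K) :
    ∃ p : GroupSeminorm (FracGroup S), ∀ a b,
      p (tau S a / tau S b) = μ.real ((a * ·) '' K ∪ (b * ·) '' K) - μ.real K := by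
  obtain ⟨u, -⟩ := exists_mem_support hμ0
  choose num den hnd using exists_eq_tau_div_tau u
  let f : FracGroup S → ℝ := fun g =>
    μ.real ((num g * ·) '' K ∪ (den g * ·) '' K) - μ.real K
  have hf : ∀ a b, f (tau S a / tau S b) =
      μ.real ((a * ·) '' K ∪ (b * ·) '' K) - μ.real K := fun a b => by
    simp only [f, Measure.real]
    rw [measure_image_union_eq_of_tau_div_eq hμ0 hμ (hnd (tau S a / tau S b)).symm hK]
  have hfin : ∀ a b, μ ((a * ·) '' K ∪ (b * ·) '' K) ≠ ⊤ := fun a b =>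
    ((hK.image_mul_left a).union (hK.image_mul_left b)).measure_lt_top.ne
  refine ⟨⟨f, ?_, fun x y => ?_, fun x => ?_⟩, hf⟩
  · rw [← div_self' (tau S u), hf, Set.union_self, Measure.real, hμ.measure_image u hK, Measure.real,
      sub_self]
  · obtain ⟨a, b, rfl⟩ := exists_eq_tau_div_tau u x
    obtain ⟨c, d, rfl⟩ := exists_eq_tau_div_tau u y
    have h1 : tau S a / tau S b = tau S (c * a) / tau S (c * b) := by
      rw [map_mul, map_mul, mul_div_mul_left_eq_div]
    have h2 : tau S c / tau S d = tau S (b * c) / tau S (b * d) := by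
      rw [map_mul, map_mul, mul_div_mul_left_eq_div]
    have h3 : tau S a / tau S b * (tau S c / tau S d) = tau S (c * a) / tau S (b * d) := by
      rw [map_mul, map_mul, div_mul_div_comm, mul_comm (tau S a)]
    rw [h3, h1, h2, hf, hf, hf, mul_comm c b]
    have h4 := measure_union_add_le (μ := μ) (A := ((c * a) * ·) '' K) (B := ((b * c) * ·) '' K)
      (C := ((b * d) * ·) '' K) (hK.image_mul_left _).measurableSet
      (hK.image_mul_left _).measurableSet
    rw [hμ.measure_image (b * c) hK] at h4
    have h5 := ENNReal.toReal_mono (ENNReal.add_ne_top.2 ⟨hfin _ _, hfin _ _⟩) h4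
    rw [ENNReal.toReal_add (hfin _ _) hK.measure_lt_top.ne,
      ENNReal.toReal_add (hfin _ _) (hfin _ _)] at h5
    simp only [Measure.real]
    linarith
  · obtain ⟨a, b, rfl⟩ := exists_eq_tau_div_tau u x
    rw [inv_div, hf, hf, Set.union_comm]

end Invariant

/-- The seminorm defines a group topology for which `τ` is continuous; the topology of `G`, being
the finest such one, refines it. -/
theorem setOf_groupSeminorm_lt_mem_nhds_one {S : Type*} [CommSemigroup S] [TopologicalSpace S]
    (p : GroupSeminorm (FracGroup S))
    (hp : ∀ t, Tendsto (fun s => p (tau S s / tau S t)) (𝓝 t) (𝓝 0)) {r : ℝ} (hr : 0 < r) :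
    {g : FracGroup S | p g < r} ∈ 𝓝 (1 : FracGroup S) := by
  let N : SeminormedCommGroup (FracGroup S) := p.toSeminormedCommGroup
  let T : GroupTopology (FracGroup S) :=
    { toTopologicalSpace := N.toPseudoMetricSpace.toUniformSpace.toTopologicalSpace
      toIsTopologicalGroup := @SeminormedCommGroup.toIsTopologicalGroup _ N }
  have hT : TopologicalSpace.coinduced (tau S) inferInstance ≤ T.toTopologicalSpace := by
    rw [← continuous_iff_coinduced_le]
    refine (@continuous_iff_continuousAt _ _ _ T.toTopologicalSpace _).2 fun t => ?_
    refine (@tendsto_iff_norm_div_tendsto_zero _ _ N _ _ _).2 ?_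
    exact hp t
  have hle : GroupTopology.coinduced (tau S) ≤ T := sInf_le hT
  have hmem : {g : FracGroup S | p g < r} ∈ @nhds _ T.toTopologicalSpace 1 := by
    have h := @Metric.ball_mem_nhds _ N.toPseudoMetricSpace 1 r hr
    convert h using 1
    ext g
    rw [@mem_ball_one_iff _ N.toSeminormedGroup]
    rfl
  exact nhds_mono hle hmem

section Invariant

variable {S : Type*} [CommSemigroup S] [TopologicalSpace S] [T2Space S] [ContinuousMul S]
  [MeasurableSpace S] [BorelSpace S] {μ : Measure S}

theorem FracGroup.t2Space_of_invariant [μ.InnerRegular] [IsLocallyFiniteMeasure μ]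
    (hμ0 : μ ≠ 0) (hμ : IsSemigroupInvariant μ) : T2Space (FracGroup S) := by
  obtain ⟨u, hu⟩ := exists_mem_support hμ0
  refine IsTopologicalGroup.t2Space_of_one_sep fun g hg => ?_
  obtain ⟨a, b, rfl⟩ := exists_eq_tau_div_tau u g
  by_contra hcon
  push Not at hcon
  refine hg (div_eq_one.2 (tau_eq_of_mul_eq_mul (u := u) ?_))
  rw [mul_comm u, mul_comm u]
  refine mul_eq_mul_of_measure_union_le hμ hu fun K hK => ?_
  obtain ⟨p, hp⟩ := exists_groupSeminorm_measure_union hμ0 hμ hK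
  have hfin : ∀ a b, μ ((a * ·) '' K ∪ (b * ·) '' K) ≠ ⊤ := fun a b =>
    ((hK.image_mul_left a).union (hK.image_mul_left b)).measure_lt_top.ne
  have hcont : ∀ t, Tendsto (fun s => p (tau S s / tau S t)) (𝓝 t) (𝓝 0) := by
    intro t
    refine (nhds_basis_Ioo_pos (0 : ℝ)).tendsto_right_iff.2 fun ε hε => ?_
    have hlt : μ K < μ K + ENNReal.ofReal ε :=
      ENNReal.lt_add_right hK.measure_lt_top.ne (ENNReal.ofReal_pos.2 hε).ne'
    filter_upwards [eventually_measure_image_union_lt hμ hK t hlt] with s hs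
    have h1 := ENNReal.toReal_strict_mono
      (ENNReal.add_ne_top.2 ⟨hK.measure_lt_top.ne, ENNReal.ofReal_ne_top⟩) hs
    rw [ENNReal.toReal_add hK.measure_lt_top.ne ENNReal.ofReal_ne_top,
      ENNReal.toReal_ofReal hε.le] at h1
    have h2 : 0 ≤ p (tau S s / tau S t) := apply_nonneg p _
    refine ⟨by linarith, ?_⟩
    rw [hp, Measure.real, Measure.real]
    linarith
  by_contra hlt
  rw [not_le] at hlt
  have hpos : 0 < p (tau S a / tau S b) := by
    rw [hp, sub_pos]
    exact ENNReal.toReal_strict_mono (hfin _ _) hlt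
  exact lt_irrefl (p (tau S a / tau S b))
    (hcon _ (setOf_groupSeminorm_lt_mem_nhds_one p hcont hpos))

/-! ### Almost everywhere injectivity of the canonical homomorphism -/

/-- For a compact `B` inside the difference, multiplication by a support point `k` sends `B` into
`kA`. By invariance `μ(A ∪ B) = μ(A)`, although `A` and `B` are disjoint. -/
theorem measure_preimage_image_tau_sdiff [μ.InnerRegular] [IsLocallyFiniteMeasure μ]
    [T2Space (FracGroup S)] (hμ0 : μ ≠ 0) (hμ : IsSemigroupInvariant μ) {A : Set S}
    (hA : IsCompact A) : μ ((tau S ⁻¹' (tau S '' A)) \ A) = 0 := by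
  obtain ⟨k, hk⟩ := exists_mem_support hμ0
  have hmeas : MeasurableSet ((tau S ⁻¹' (tau S '' A)) \ A) :=
    ((hA.image (continuous_tau S)).isClosed.preimage (continuous_tau S)).measurableSet.diff
      hA.measurableSet
  by_contra hne
  obtain ⟨B, hBs, hB, hB0⟩ := hmeas.exists_lt_isCompact (pos_iff_ne_zero.2 hne)
  have hsub : (k * ·) '' B ⊆ (k * ·) '' A := by
    rintro _ ⟨b, hb, rfl⟩
    obtain ⟨a, ha, hab⟩ := (hBs hb).1
    refine ⟨a, ha, ?_⟩
    have := mul_eq_mul_of_tau_eq hμ hk hab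
    simpa only [mul_comm k] using this
  have h1 : μ (A ∪ B) = μ A := by
    rw [← hμ.measure_image k (hA.union hB), Set.image_union, Set.union_eq_left.2 hsub,
      hμ.measure_image k hA]
  rw [measure_union (Set.disjoint_left.2 fun x hx hx' => (hBs hx').2 hx) hB.measurableSet] at h1
  exact (ENNReal.lt_add_right hA.measure_lt_top.ne hB0.ne').ne' h1

end Invariant

/-! ### A Fubini theorem for compact sets -/

/-- A compact subset of a product is null for the product measure if its vertical sections are null.
No relation between the product `σ`-algebra and the Borel sets of the product is assumed. -/
theorem measure_prod_eq_zero_of_isCompact {X Y : Type*} [TopologicalSpace X] [TopologicalSpace Y]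
    [T2Space X] [R1Space Y] [MeasurableSpace X] [MeasurableSpace Y] [BorelSpace X] [BorelSpace Y]
    (μ : Measure X) (ν : Measure Y) [IsFiniteMeasure μ] [IsFiniteMeasure ν]
    [ν.InnerRegularCompactLTTop] {C : Set (X × Y)} (hC : IsCompact C)
    (h : ∀ x, ν (Prod.mk x ⁻¹' C) = 0) : μ.prod ν C = 0 := by
  have key : ∀ ε : ENNReal, ε ≠ 0 → μ.prod ν C ≤ ε * μ Set.univ := by
    intro ε hε
    -- Demanding the bound for every measurable `B ⊆ A'` allows overlapping pieces to be made
    -- disjoint without doubling the constant.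
    have hind : ∃ A', Prod.fst '' C ⊆ A' ∧ MeasurableSet A' ∧ ∀ B ⊆ A', MeasurableSet B →
        μ.prod ν (C ∩ B ×ˢ Set.univ) ≤ ε * μ B := by
      refine (hC.image continuous_fst).induction_on
        (p := fun A => ∃ A', A ⊆ A' ∧ MeasurableSet A' ∧ ∀ B ⊆ A', MeasurableSet B →
          μ.prod ν (C ∩ B ×ˢ Set.univ) ≤ ε * μ B)
        ⟨∅, le_rfl, .empty, fun B hB _ => by simp [Set.subset_empty_iff.1 hB]⟩
        (fun A₁ A₂ hA ⟨A', h1, h2⟩ => ⟨A', hA.trans h1, h2⟩) ?_ ?_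
      · rintro A₁ A₂ ⟨A₁', h1, hm1, hb1⟩ ⟨A₂', h2, hm2, hb2⟩
        refine ⟨A₁' ∪ A₂', Set.union_subset_union h1 h2, hm1.union hm2, fun B hB hBm => ?_⟩
        have hsplit : C ∩ B ×ˢ Set.univ =
            C ∩ (B ∩ A₁') ×ˢ Set.univ ∪ C ∩ (B \ A₁') ×ˢ Set.univ := by
          rw [← Set.inter_union_distrib_left, ← Set.union_prod, Set.inter_union_sdiff]
        rw [hsplit, ← measure_inter_add_sdiff B hm1, mul_add]
        refine (measure_union_le _ _).trans (add_le_add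
          (hb1 _ Set.inter_subset_right (hBm.inter hm1)) (hb2 _ ?_ (hBm.diff hm1)))
        exact fun x hx => (hB hx.1).resolve_left hx.2
      · intro x _
        -- By compactness of `C`, the sections over points near `x` stay inside an open `V` with `ν
        -- V < ε`.
        obtain ⟨V, hxV, hV, hVε⟩ :=
          (Prod.mk x ⁻¹' C).exists_isOpen_lt_of_lt (μ := ν) ε (by rw [h x]; exact hε.bot_lt)
        have hcl : IsClosed (Prod.fst '' (C ∩ Prod.snd ⁻¹' Vᶜ)) :=
          ((hC.inter_right (hV.isClosed_compl.preimage continuous_snd)).image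
            continuous_fst).isClosed
        have hmem : (Prod.fst '' (C ∩ Prod.snd ⁻¹' Vᶜ))ᶜ ∈ 𝓝 x := by
          refine hcl.isOpen_compl.mem_nhds ?_
          rintro ⟨⟨x', y⟩, ⟨hxy, hy⟩, rfl⟩
          exact hy (hxV hxy)
        refine ⟨_, mem_nhdsWithin_of_mem_nhds hmem, _, le_rfl, hcl.isOpen_compl.measurableSet,
          fun B hB hBm => ?_⟩
        have hsub : C ∩ B ×ˢ Set.univ ⊆ B ×ˢ V := by
          rintro ⟨x', y⟩ ⟨hxy, hx', -⟩
          refine ⟨hx', ?_⟩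
          by_contra hy
          exact hB hx' ⟨(x', y), ⟨hxy, hy⟩, rfl⟩
        refine (measure_mono hsub).trans ?_
        rw [Measure.prod_prod, mul_comm]
        gcongr
    obtain ⟨A', hCA, hm, hb⟩ := hind
    have hCeq : C ∩ A' ×ˢ Set.univ = C :=
      Set.inter_eq_left.2 fun z hz => ⟨hCA ⟨z, hz, rfl⟩, trivial⟩
    calc μ.prod ν C = μ.prod ν (C ∩ A' ×ˢ Set.univ) := by rw [hCeq]
      _ ≤ ε * μ A' := hb A' le_rfl hm
      _ ≤ ε * μ Set.univ := by gcongr; exact Set.subset_univ _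
  suffices Tendsto (fun ε : ENNReal => ε * μ Set.univ) (𝓝[>] 0) (𝓝 0) from
    le_antisymm (ge_of_tendsto this (eventually_mem_nhdsWithin.mono fun ε hε =>
      key ε (ne_of_gt hε))) bot_le
  have := ENNReal.Tendsto.mul_const (b := μ Set.univ) (tendsto_id (x := 𝓝 (0 : ENNReal)))
    (Or.inr (measure_ne_top μ _))
  rw [zero_mul] at this
  exact this.mono_left nhdsWithin_le_nhds

section Invariant

open scoped Pointwise

variable {S : Type*} [CommSemigroup S] [TopologicalSpace S] [T2Space S] [ContinuousMul S]
  [MeasurableSpace S] [BorelSpace S] {μ : Measure S}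

/-! ### Reflection of null sets -/

/-- A compact `E` of positive measure in the reflected set would give a compact `C ⊆ UE × tU` of
pairs with `τ(x)⁻¹τ(y) ∈ N`. Its sections over `x` are null by invariance, while the section over `y
= tu` contains `uE`, of measure `μ(E) > 0`. This contradicts Fubini. -/
theorem measure_preimage_div_eq_zero [μ.InnerRegular] [IsLocallyFiniteMeasure μ]
    (hμ0 : μ ≠ 0) (hμ : IsSemigroupInvariant μ) {N : Set (FracGroup S)} (hN : MeasurableSet N)
    (hNsub : N ⊆ Set.range (tau S)) (hN0 : μ (tau S ⁻¹' N) = 0) (t : S) :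
    μ {s | (tau S s)⁻¹ * tau S t ∈ N} = 0 := by
  obtain ⟨k, hk⟩ := exists_mem_support hμ0
  have hcont : Continuous fun s => (tau S s)⁻¹ * tau S t :=
    (continuous_tau S).inv.mul continuous_const
  by_contra hne
  obtain ⟨E, hEs, hE, hE0⟩ :=
    (hN.preimage hcont.measurable).exists_lt_isCompact (pos_iff_ne_zero.2 hne)
  obtain ⟨U, -, hU, hU0⟩ := exists_isCompact_subset_measure_pos hk isOpen_univ (Set.mem_univ k)
  have hX : IsCompact (U * E) := hU.mul hE
  have hY : IsCompact ((t * ·) '' U) := hU.image_mul_left t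
  -- The equation forces `τ(x)⁻¹τ(y) = τ(e)⁻¹τ(t)`; stated in `S`, with `e` ranging over `E`, it
  -- defines a compact set.
  let C : Set (S × S) :=
    Prod.fst '' ((((U * E) ×ˢ ((t * ·) '' U)) ×ˢ E) ∩
      {z : (S × S) × S | k * z.1.2 * z.2 = k * z.1.1 * t})
  have hC : IsCompact C :=
    (((hX.prod hY).prod hE).inter_right
      (isClosed_eq (by fun_prop) (by fun_prop))).image continuous_fst
  have hCmem : ∀ x y, (x, y) ∈ C ↔
      (x ∈ U * E ∧ y ∈ (t * ·) '' U) ∧ ∃ e ∈ E, k * y * e = k * x * t := by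
    intro x y
    constructor
    · rintro ⟨⟨⟨x', y'⟩, e⟩, ⟨⟨⟨hx, hy⟩, he⟩, h⟩, heq⟩
      obtain ⟨rfl, rfl⟩ := Prod.mk.inj heq
      exact ⟨⟨hx, hy⟩, e, he, h⟩
    · rintro ⟨⟨hx, hy⟩, e, he, h⟩
      exact ⟨((x, y), e), ⟨⟨⟨hx, hy⟩, he⟩, h⟩, rfl⟩
  have hsec : ∀ x, μ (Prod.mk x ⁻¹' C) = 0 := by
    intro x
    have hquot : ∀ y, (x, y) ∈ C → (tau S x)⁻¹ * tau S y ∈ N := by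
      intro y hy
      obtain ⟨-, e, he, h⟩ := (hCmem x y).1 hy
      have h1 : (tau S e)⁻¹ * tau S t ∈ N := hEs he
      have h2 := congrArg (tau S) h
      simp only [map_mul, mul_assoc, mul_right_inj] at h2
      have h3 : (tau S x)⁻¹ * tau S y = (tau S e)⁻¹ * tau S t := by
        rw [inv_mul_eq_iff_eq_mul, ← mul_assoc, mul_comm (tau S x), mul_assoc, ← h2,
          mul_comm (tau S y), inv_mul_cancel_left]
      rwa [h3]
    have hD : IsCompact (Prod.mk x ⁻¹' C) := by
      have h1 : IsCompact (Prod.snd '' (C ∩ {z | z.1 = x})) :=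
        (hC.inter_right (isClosed_eq continuous_fst continuous_const)).image continuous_snd
      convert h1 using 1
      ext y
      constructor
      · exact fun hy => ⟨(x, y), ⟨hy, rfl⟩, rfl⟩
      · rintro ⟨⟨x', y'⟩, ⟨hz, rfl⟩, rfl⟩
        exact hz
    -- The relation `τ(xn) = τ(y)` yields only `kxn = ky`, so the section is moved by `k` before
    -- dividing by `kx`.
    rw [← hμ.measure_image k hD, ← hμ.measure_preimage (k * x) (hD.image_mul_left k).measurableSet]
    · refine measure_mono_null ?_ hN0
      rintro n ⟨y, hy, hyn⟩
      have h1 := hquot y hy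
      have h2 := congrArg (tau S) hyn
      simp only [map_mul, mul_assoc, mul_right_inj] at h2
      rwa [h2, inv_mul_cancel_left] at h1
    · rintro _ ⟨y, hy, rfl⟩
      obtain ⟨n, hn⟩ := hNsub (hquot y hy)
      refine ⟨n, ?_⟩
      have h1 : tau S (x * n) = tau S y := by rw [map_mul, hn, mul_inv_cancel_left]
      have h2 := mul_eq_mul_of_tau_eq hμ hk h1
      calc k * x * n = x * n * k := by ac_rfl
        _ = y * k := h2
        _ = k * y := mul_comm _ _
  have hXfin : IsFiniteMeasure (μ.restrict (U * E)) := ⟨by simpa using hX.measure_lt_top⟩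
  have hYfin : IsFiniteMeasure (μ.restrict ((t * ·) '' U)) := ⟨by simpa using hY.measure_lt_top⟩
  have h0 : (μ.restrict (U * E)).prod (μ.restrict ((t * ·) '' U)) C = 0 :=
    measure_prod_eq_zero_of_isCompact _ _ hC fun x =>
      le_antisymm ((Measure.restrict_apply_le _ _).trans (hsec x).le) bot_le
  have h1 := (Measure.measurePreserving_swap (μ := μ.restrict ((t * ·) '' U))
    (ν := μ.restrict (U * E))).quasiMeasurePreserving.preimage_null h0
  have h2 := ae_restrict_iff' hY.measurableSet |>.1 (Measure.measure_ae_null_of_prod_null h1)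
  have hpos : μ ((t * ·) '' U) ≠ 0 := by rw [hμ.measure_image t hU]; exact hU0.ne'
  refine hpos (measure_mono_null ?_ h2)
  rintro _ ⟨u, hu, rfl⟩ hcon
  have h3 : μ.restrict (U * E) (Prod.mk (t * u) ⁻¹' (Prod.swap ⁻¹' C)) = 0 := hcon ⟨u, hu, rfl⟩
  refine hE0.ne' ?_
  rw [← hμ.measure_image u hE]
  rw [Measure.restrict_apply' hX.measurableSet] at h3
  refine measure_mono_null ?_ h3
  rintro _ ⟨e, he, rfl⟩
  have hue : u * e ∈ U * E := Set.mul_mem_mul hu he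
  refine ⟨(hCmem _ _).2 ⟨⟨hue, u, hu, rfl⟩, e, he, ?_⟩, hue⟩
  change k * (t * u) * e = k * (u * e) * t
  ac_rfl

end Invariant

section Invariant

variable {S : Type*} [CommSemigroup S] [TopologicalSpace S] [T2Space S] [ContinuousMul S]
  [MeasurableSpace S] [BorelSpace S] {μ : Measure S}

/-! ### Factorization of measurable functions -/

/-- The set is exhausted from inside by compact sets up to a null set; their images are closed in
`G`, and passing to saturations adds only null sets. -/
theorem exists_measurableSet_ae_mem_iff_of_measure_ne_top [μ.InnerRegular]
    [IsLocallyFiniteMeasure μ] [T2Space (FracGroup S)] (hμ0 : μ ≠ 0)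
    (hμ : IsSemigroupInvariant μ) {s : Set S} (hs : MeasurableSet s) (hfin : μ s ≠ ⊤) :
    ∃ t : Set (FracGroup S), MeasurableSet t ∧ ∀ᵐ x ∂μ, x ∈ s ↔ tau S x ∈ t := by
  have hex : ∀ n : ℕ, ∃ C ⊆ s, IsCompact C ∧ μ (s \ C) < ((n : ENNReal) + 1)⁻¹ := fun n =>
    hs.exists_isCompact_sdiff_lt hfin (by simp)
  choose C hCs hC hlt using hex
  refine ⟨⋃ n, tau S '' C n,
    .iUnion fun n => ((hC n).image (continuous_tau S)).isClosed.measurableSet, ?_⟩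
  have h1 : ∀ᵐ x ∂μ, x ∉ s \ ⋃ n, C n := by
    refine measure_eq_zero_iff_ae_notMem.1 (le_antisymm ?_ bot_le)
    refine ge_of_tendsto' (f := fun n : ℕ => ((n : ENNReal) + 1)⁻¹) (x := atTop) ?_ fun n =>
      (measure_mono (Set.sdiff_subset_sdiff_right (Set.subset_iUnion C n))).trans (hlt n).le
    simpa using (tendsto_add_atTop_iff_nat 1).2 ENNReal.tendsto_inv_nat_nhds_zero
  have h2 : ∀ᵐ x ∂μ, ∀ n, x ∉ (tau S ⁻¹' (tau S '' C n)) \ C n :=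
    ae_all_iff.2 fun n => measure_eq_zero_iff_ae_notMem.1
      (measure_preimage_image_tau_sdiff hμ0 hμ (hC n))
  filter_upwards [h1, h2] with x hx1 hx2
  constructor
  · intro hx
    obtain ⟨n, hn⟩ := Set.mem_iUnion.1 (by_contra fun h => hx1 ⟨hx, h⟩)
    exact Set.mem_iUnion.2 ⟨n, x, hn, rfl⟩
  · intro hx
    obtain ⟨n, hn⟩ := Set.mem_iUnion.1 hx
    exact hCs n (by_contra fun h => hx2 n ⟨hn, h⟩)

theorem exists_measurableSet_ae_mem_iff [μ.InnerRegular] [IsLocallyFiniteMeasure μ]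
    [T2Space (FracGroup S)] (hμ0 : μ ≠ 0) (hμ : IsSemigroupInvariant μ) {K : ℕ → Set S}
    (hK : ∀ n, IsCompact (K n)) {s : Set S} (hs : MeasurableSet s) (hsK : s ⊆ ⋃ n, K n) :
    ∃ t : Set (FracGroup S), MeasurableSet t ∧ ∀ᵐ x ∂μ, x ∈ s ↔ tau S x ∈ t := by
  choose t ht hst using fun n => exists_measurableSet_ae_mem_iff_of_measure_ne_top hμ0 hμ
    (hs.inter (hK n).measurableSet)
    (ne_top_of_le_ne_top (hK n).measure_lt_top.ne (measure_mono Set.inter_subset_right))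
  refine ⟨⋃ n, t n, .iUnion ht, ?_⟩
  filter_upwards [ae_all_iff.2 hst] with x hx
  simp only [Set.mem_iUnion, ← hx, Set.mem_inter_iff, exists_and_left]
  exact ⟨fun h => ⟨h, Set.mem_iUnion.1 (hsK h)⟩, And.left⟩

theorem exists_measurable_comp_tau_ae_eq [μ.InnerRegular] [IsLocallyFiniteMeasure μ]
    [T2Space (FracGroup S)] (hμ0 : μ ≠ 0) (hμ : IsSemigroupInvariant μ) {K : ℕ → Set S}
    (hK : ∀ n, IsCompact (K n)) {g : S → ℂ} (hg : StronglyMeasurable g) :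
    ∃ h : FracGroup S → ℂ, StronglyMeasurable h ∧ ∀ᵐ x ∂μ, x ∈ ⋃ n, K n → g x = h (tau S x) := by
  have hL : MeasurableSet (⋃ n, K n) := .iUnion fun n => (hK n).measurableSet
  classical
  induction g, hg using StronglyMeasurable.induction' with
  | const z => exact ⟨fun _ => z, stronglyMeasurable_const, .of_forall fun _ _ => rfl⟩
  | @pcw g₁ g₂ s hg₁ hg₂ hs h₁ h₂ =>
    obtain ⟨h₁, mh₁, e₁⟩ := h₁
    obtain ⟨h₂, mh₂, e₂⟩ := h₂
    obtain ⟨t, ht, hst⟩ := exists_measurableSet_ae_mem_iff hμ0 hμ hK (hs.inter hL)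
      Set.inter_subset_right
    refine ⟨t.piecewise h₁ h₂, mh₁.piecewise ht mh₂, ?_⟩
    filter_upwards [e₁, e₂, hst] with x hx₁ hx₂ hx hxL
    by_cases hxs : x ∈ s
    · rw [Set.piecewise_eq_of_mem _ _ _ hxs, Set.piecewise_eq_of_mem _ _ _ (hx.1 ⟨hxs, hxL⟩),
        hx₁ hxL]
    · rw [Set.piecewise_eq_of_notMem _ _ _ hxs,
        Set.piecewise_eq_of_notMem _ _ _ fun h => hxs (hx.2 h).1, hx₂ hxL]
  | @lim f g hf hg h₁ hlim =>
    choose h mh hh using h₁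
    refine ⟨fun y => limUnder atTop (h · y), StronglyMeasurable.limUnder mh, ?_⟩
    filter_upwards [ae_all_iff.2 hh] with x hx hxL
    rw [Tendsto.limUnder_eq]
    have := hlim x
    simpa only [hx _ hxL] using this

/-- A function that vanishes at infinity after multiplication by a positive weight is factorizable. -/
theorem exists_isFactorization [μ.InnerRegular] [IsLocallyFiniteMeasure μ]
    [T2Space (FracGroup S)] (hμ0 : μ ≠ 0) (hμ : IsSemigroupInvariant μ) {w : S → ℝ}
    (hw : ∀ s, 0 < w s) {F : S → ℂ} (hF : AEMeasurable F μ)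
    (hF0 : TendsAtInfty μ (fun s => F s * (w s : ℂ)) 0) :
    ∃ F' : tauRange S → ℂ, IsFactorization μ F F' := by
  choose K hK hKF using fun n : ℕ => hF0 ((n : ℝ) + 1)⁻¹ (by positivity)
  obtain ⟨h, hh, heq⟩ := exists_measurable_comp_tau_ae_eq hμ0 hμ hK
    hF.measurable_mk.stronglyMeasurable
  obtain ⟨t, ht, hLt⟩ := exists_measurableSet_ae_mem_iff hμ0 hμ hK
    (.iUnion fun n => (hK n).measurableSet) le_rfl
  refine ⟨fun σ => t.indicator h σ, (hh.measurable.indicator ht).comp measurable_subtype_coe, ?_⟩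
  filter_upwards [hF.ae_eq_mk, heq, hLt, ae_all_iff.2 hKF] with x hx1 hx2 hx3 hx4
  change F x = t.indicator h (tau S x)
  by_cases hx : x ∈ ⋃ n, K n
  · rw [Set.indicator_of_mem (hx3.1 hx), hx1, hx2 hx]
  · rw [Set.indicator_of_notMem fun h => hx (hx3.2 h)]
    -- Off the σ-compact set, `|Fw|` is below `1/(n+1)` for every `n`, so `F` vanishes there a.e.
    have h1 : ‖F x * (w x : ℂ)‖ ≤ 0 := by
      refine ge_of_tendsto' (f := fun n : ℕ => ((n : ℝ) + 1)⁻¹) (x := atTop) ?_ fun n => ?_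
      · simpa using tendsto_one_div_add_atTop_nhds_zero_nat (𝕜 := ℝ)
      · have := hx4 n fun h => hx (Set.mem_iUnion.2 ⟨n, h⟩)
        simpa using this.le
    have h2 := norm_le_zero_iff.1 h1
    exact (mul_eq_zero.1 h2).resolve_right (by exact_mod_cast (hw x).ne')

/-- An integrable function is concentrated on compact sets up to a small error. -/
theorem exists_isCompact_setIntegral_compl_lt {X : Type*} [TopologicalSpace X] [T2Space X]
    [MeasurableSpace X] [BorelSpace X] {μ : Measure X} [μ.InnerRegular] {f : X → ℝ}
    (hf : Integrable f μ) (hf0 : ∀ x, 0 ≤ f x) {ε : ℝ} (hε : 0 < ε) :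
    ∃ L, IsCompact L ∧ ∫ x in Lᶜ, f x ∂μ < ε := by
  have hfin : ∫⁻ x, ENNReal.ofReal (f x) ∂μ ≠ ⊤ :=
    ((hasFiniteIntegral_iff_ofReal (.of_forall hf0)).1 hf.2).ne
  have hε2 : ENNReal.ofReal (ε / 2) ≠ 0 := (ENNReal.ofReal_pos.2 (half_pos hε)).ne'
  obtain ⟨A, hA, hAfin, hAlt⟩ := exists_setLIntegral_compl_lt hfin hε2
  obtain ⟨δ, hδ, hδlt⟩ := exists_pos_setLIntegral_lt_of_measure_lt hfin hε2
  obtain ⟨L, hLA, hL, hlt⟩ := hA.exists_isCompact_sdiff_lt hAfin.ne hδ.ne'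
  refine ⟨L, hL, ?_⟩
  have h1 : ∫⁻ x in Lᶜ, ENNReal.ofReal (f x) ∂μ < ENNReal.ofReal ε := by
    have hsub : Lᶜ ⊆ A \ L ∪ Aᶜ := fun x hx => by
      by_cases h : x ∈ A
      exacts [Or.inl ⟨h, hx⟩, Or.inr h]
    calc ∫⁻ x in Lᶜ, ENNReal.ofReal (f x) ∂μ
        ≤ ∫⁻ x in A \ L ∪ Aᶜ, ENNReal.ofReal (f x) ∂μ := lintegral_mono_set hsub
      _ ≤ ∫⁻ x in A \ L, ENNReal.ofReal (f x) ∂μ + ∫⁻ x in Aᶜ, ENNReal.ofReal (f x) ∂μ :=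
        lintegral_union_le _ _ _
      _ < ENNReal.ofReal (ε / 2) + ENNReal.ofReal (ε / 2) := ENNReal.add_lt_add (hδlt _ hlt) hAlt
      _ = ENNReal.ofReal ε := by
        rw [← ENNReal.ofReal_add (half_pos hε).le (half_pos hε).le, add_halves]
  rw [← ofReal_integral_eq_lintegral_ofReal hf.restrict (.of_forall hf0)] at h1
  exact (ENNReal.ofReal_lt_ofReal_iff hε).1 h1

/-! ### The convolution -/

theorem zeroExtend_tau {S : Type*} [CommSemigroup S] (F' : tauRange S → ℂ) (s : S) :
    zeroExtend F' (tau S s) = F' ((tau S).srangeRestrict s) :=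
  Subtype.val_injective.extend_apply F' 0 ((tau S).srangeRestrict s)

theorem zeroExtend_eq_zero {S : Type*} [CommSemigroup S] (F' : tauRange S → ℂ) {g : FracGroup S}
    (hg : g ∉ Set.range (tau S)) : zeroExtend F' g = 0 := by
  refine Function.extend_apply' _ _ _ ?_
  rintro ⟨⟨_, s, rfl⟩, rfl⟩
  exact hg ⟨s, rfl⟩

/-- The weighted modulus of a function on `τ(S)`, extended by zero to the group. -/
noncomputable def weightedModulus {S : Type*} [CommSemigroup S] (F' : tauRange S → ℂ)
    (w' : tauRange S → ℝ) (g : FracGroup S) : ℝ :=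
  ‖zeroExtend F' g * zeroExtend (fun σ => (w' σ : ℂ)) g‖

theorem measurable_zeroExtend {S : Type*} [CommSemigroup S] [TopologicalSpace S]
    (hBorel : MeasurableSet (tauRange S : Set (FracGroup S))) {F' : tauRange S → ℂ}
    (hF' : Measurable F') : Measurable (zeroExtend F') :=
  (MeasurableEmbedding.subtype_coe hBorel).measurable_extend hF' measurable_const

theorem measurable_weightedModulus {S : Type*} [CommSemigroup S] [TopologicalSpace S]
    (hBorel : MeasurableSet (tauRange S : Set (FracGroup S))) {F' : tauRange S → ℂ}
    (hF' : Measurable F') {w' : tauRange S → ℝ} (hw' : Measurable w') :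
    Measurable (weightedModulus F' w') :=
  ((measurable_zeroExtend hBorel hF').mul
    (measurable_zeroExtend hBorel (Complex.measurable_ofReal.comp hw'))).norm

/-- Almost everywhere bounds for `F w` on a measurable `τ`-saturated set reflect to bounds for the
shifts of `F`. -/
theorem ae_weightedModulus_le [μ.InnerRegular] [IsLocallyFiniteMeasure μ] (hμ0 : μ ≠ 0)
    (hμ : IsSemigroupInvariant μ)
    (hBorel : MeasurableSet (tauRange S : Set (FracGroup S))) {F : S → ℂ} {F' : tauRange S → ℂ}
    (hF' : IsFactorization μ F F') {w : S → ℝ} {w' : tauRange S → ℝ} (hw' : Measurable w')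
    (hww' : ∀ s, w s = w' ((tau S).srangeRestrict s)) {C : ℝ} (hC : 0 ≤ C)
    {P : Set (FracGroup S)} (hP : MeasurableSet P)
    (hbound : ∀ᵐ s ∂μ, tau S s ∈ P → ‖F s * (w s : ℂ)‖ ≤ C) (t : S) :
    ∀ᵐ s ∂μ, (tau S s)⁻¹ * tau S t ∈ P →
      weightedModulus F' w' ((tau S s)⁻¹ * tau S t) ≤ C := by
  have hN := measure_preimage_div_eq_zero hμ0 hμ (N := P ∩ {g | C < weightedModulus F' w' g})
    (hP.inter (measurableSet_lt measurable_const
      (measurable_weightedModulus hBorel hF'.1 hw'))) ?_ ?_ t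
  · filter_upwards [measure_eq_zero_iff_ae_notMem.1 hN] with s hs hsP
    exact not_lt.1 fun h => hs ⟨hsP, h⟩
  -- The exceptional set lies in `τ(S)` because the modulus is zero elsewhere and `C ≥ 0`.
  · rintro g ⟨-, hg⟩
    by_contra h
    rw [Set.mem_ofPred_eq, weightedModulus, zeroExtend_eq_zero F' h, zero_mul, norm_zero] at hg
    exact hg.not_ge hC
  · rw [measure_eq_zero_iff_ae_notMem]
    filter_upwards [hbound, hF'.2] with s hs hFs hmem
    have h1 : C < weightedModulus F' w' (tau S s) := hmem.2
    rw [weightedModulus, zeroExtend_tau, zeroExtend_tau, ← hFs, ← hww'] at h1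
    exact h1.not_ge (hs hmem.1)

/-- Where the shift can be nonzero, `τ(t) = τ(s)τ(n)` for some `n`, whence `w(t) ≤ w(s)w(n)`. -/
theorem norm_semigroupShift_mul_le {S : Type*} [CommSemigroup S] {F' : tauRange S → ℂ}
    {w : S → ℝ} {w' : tauRange S → ℝ} (hw : ∀ s, 0 < w s)
    (hsub : ∀ σ ρ, w' (σ * ρ) ≤ w' σ * w' ρ)
    (hww' : ∀ s, w s = w' ((tau S).srangeRestrict s)) (s t : S) :
    ‖semigroupShift F' s t‖ * w t ≤ weightedModulus F' w' ((tau S s)⁻¹ * tau S t) * w s := by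
  by_cases h : (tau S s)⁻¹ * tau S t ∈ Set.range (tau S)
  · obtain ⟨n, hn⟩ := h
    have ht : (tau S).srangeRestrict t =
        (tau S).srangeRestrict s * (tau S).srangeRestrict n := by
      apply Subtype.ext
      change tau S t = tau S s * tau S n
      rw [hn, mul_inv_cancel_left]
    have hle : w t ≤ w s * w n := by
      rw [hww' t, hww' s, hww' n, ht]
      exact hsub _ _
    rw [semigroupShift, ← hn, weightedModulus, zeroExtend_tau _ n, norm_mul, zeroExtend_tau _ n,
      ← hww', Complex.norm_real, Real.norm_of_nonneg (hw n).le, mul_assoc, mul_comm (w n)]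
    gcongr
  · rw [semigroupShift, zeroExtend_eq_zero F' h, norm_zero, zero_mul]
    exact mul_nonneg (norm_nonneg _) (hw s).le

theorem MemL1Weight.aestronglyMeasurable {S : Type*} [MeasurableSpace S] {μ : Measure S}
    {w : S → ℝ} (hw : Measurable w) (hpos : ∀ s, 0 < w s) {k : S → ℂ} (hk : MemL1Weight μ w k) :
    AEStronglyMeasurable k μ :=
  AEStronglyMeasurable.mono_ac (withDensity_absolutelyContinuous'
    hw.ennreal_ofReal.aemeasurable (.of_forall fun s => (ENNReal.ofReal_pos.2 (hpos s)).ne'))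
    (Integrable.aestronglyMeasurable hk)

theorem MemL1Weight.integrable_norm_mul {S : Type*} [MeasurableSpace S] {μ : Measure S}
    {w : S → ℝ} (hw : Measurable w) (hpos : ∀ s, 0 < w s) {k : S → ℂ} (hk : MemL1Weight μ w k) :
    Integrable (fun s => ‖k s‖ * w s) μ := by
  have h1 := (integrable_withDensity_iff_integrable_smul' hw.ennreal_ofReal
    (.of_forall fun _ => ENNReal.ofReal_lt_top)).1 (Integrable.norm hk)
  refine h1.congr (.of_forall fun s => ?_)
  simp only [smul_eq_mul, ENNReal.toReal_ofReal (hpos s).le, mul_comm]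

end Invariant

/-! ### Existence and decay of the convolution -/

theorem mainTheorem2 {S : Type*} [CommSemigroup S] [TopologicalSpace S] [T2Space S]
    [ContinuousMul S] [MeasurableSpace S] [BorelSpace S]
    (μ : Measure S) [μ.InnerRegular] [IsLocallyFiniteMeasure μ]
    (hμ0 : μ ≠ 0) (hμ : IsSemigroupInvariant μ)
    (hBorel : MeasurableSet (tauRange S : Set (FracGroup S)))
    (w : S → ℝ) (hw : IsWeight w) (hw_fac : IsFactorizableWeight w) (hw_pos : ∀ s, 0 < w s)
    (F k : S → ℂ) (hF : AEMeasurable F μ) (hFw : MemLp (fun s => F s * (w s : ℂ)) ⊤ μ)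
    (hk : MemL1Weight μ w k)
    (hF0 : TendsAtInfty μ (fun s => F s * (w s : ℂ)) 0) :
    (∃ F' : tauRange S → ℂ, IsFactorization μ F F') ∧
    ∀ F' : tauRange S → ℂ, IsFactorization μ F F' →
      (∀ t, ConvExistsAt μ F' k t) ∧
      TendsAtInfty μ (fun t => semigroupConv μ F' k t * (w t : ℂ)) 0 ∧
      (IsCancelMul S → TendsAtInftyEverywhere (fun t => semigroupConv μ F' k t * (w t : ℂ)) 0) := by
  have := FracGroup.t2Space_of_invariant hμ0 hμ
  refine ⟨exists_isFactorization hμ0 hμ hw_pos hF hF0, fun F' hF' => ?_⟩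
  obtain ⟨w', hw', hww'⟩ := hw_fac
  obtain ⟨C, hC0, hC⟩ : ∃ C : ℝ, 0 ≤ C ∧ ∀ᵐ s ∂μ, ‖F s * (w s : ℂ)‖ ≤ C := by
    refine ⟨(eLpNorm (fun s => F s * (w s : ℂ)) ⊤ μ).toReal, ENNReal.toReal_nonneg, ?_⟩
    have h := ae_le_eLpNormEssSup (f := fun s => F s * (w s : ℂ)) (μ := μ)
    filter_upwards [h] with s hs
    rw [← eLpNorm_exponent_top] at hs
    simpa using ENNReal.toReal_mono hFw.2.ne hs
  have hkw := hk.integrable_norm_mul hw.measurable hw_pos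
  have hbound : ∀ t, ∀ᵐ s ∂μ, weightedModulus F' w' ((tau S s)⁻¹ * tau S t) ≤ C := fun t =>
    (ae_weightedModulus_le hμ0 hμ hBorel hF' hw'.measurable hww' hC0 .univ
      (hC.mono fun s hs _ => hs) t).mono fun s hs => hs trivial
  have hshift : ∀ s t, ‖semigroupShift F' s t * k s‖ * w t ≤
      weightedModulus F' w' ((tau S s)⁻¹ * tau S t) * (‖k s‖ * w s) := fun s t => by
    have := norm_semigroupShift_mul_le (F' := F') hw_pos hw'.submul hww' s t
    calc ‖semigroupShift F' s t * k s‖ * w t = ‖semigroupShift F' s t‖ * w t * ‖k s‖ := by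
          rw [norm_mul]; ring
      _ ≤ weightedModulus F' w' ((tau S s)⁻¹ * tau S t) * w s * ‖k s‖ := by gcongr
      _ = _ := by ring
  have hconv : ∀ t, ConvExistsAt μ F' k t := fun t => by
    have hm : Measurable fun s => semigroupShift F' s t :=
      (measurable_zeroExtend hBorel hF'.1).comp
        ((continuous_tau S).inv.mul continuous_const).measurable
    refine (hkw.const_mul (C / w t)).mono' (hm.aestronglyMeasurable.mul
      (hk.aestronglyMeasurable hw.measurable hw_pos)) ?_
    filter_upwards [hbound t] with s hs
    rw [div_mul_eq_mul_div, le_div_iff₀ (hw_pos t)]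
    have h0 : 0 ≤ ‖k s‖ * w s := mul_nonneg (norm_nonneg _) (hw_pos s).le
    exact (hshift s t).trans (by gcongr)
  -- The estimate holds at every point off the saturation of a compact set. That saturation exceeds
  -- the compact set by a null set in general, and equals it when `S` is cancellative.
  have key : ∀ ε : ℝ, 0 < ε → ∃ K, IsCompact K ∧ ∀ t, t ∉ tau S ⁻¹' (tau S '' K) →
      ‖semigroupConv μ F' k t * (w t : ℂ)‖ < ε := by
    intro ε hε
    set M := ∫ s, ‖k s‖ * w s ∂μ with hM
    have hpos : ∀ s, 0 ≤ ‖k s‖ * w s := fun s => mul_nonneg (norm_nonneg _) (hw_pos s).le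
    have hM0 : 0 ≤ M := integral_nonneg hpos
    -- Each of the two parts of the integral contributes at most `ε/2`; the `+ 1` in `C + 1` and `M
    -- + 1` covers the case of zero constants.
    obtain ⟨L, hL, hLε⟩ := exists_isCompact_setIntegral_compl_lt hkw hpos
      (ε := ε / (2 * (C + 1))) (by positivity)
    obtain ⟨K, hK, hKε⟩ := hF0 (ε / (2 * (M + 1))) (by positivity)
    refine ⟨(fun p : S × S => p.1 * p.2) '' (L ×ˢ K), (hL.prod hK).image continuous_mul,
      fun t ht => ?_⟩
    have hsmall := ae_weightedModulus_le hμ0 hμ hBorel hF' hw'.measurable hww'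
      (C := ε / (2 * (M + 1))) (by positivity)
      (P := (tau S '' K)ᶜ) (hK.image (continuous_tau S)).isClosed.measurableSet.compl
      (hKε.mono fun s hs hsP => by simpa using (hs fun h => hsP ⟨s, h, rfl⟩).le) t
    have hLc : MeasurableSet Lᶜ := hL.measurableSet.compl
    have hle : ∀ᵐ s ∂μ, ‖semigroupShift F' s t * k s * (w t : ℂ)‖ ≤
        ε / (2 * (M + 1)) * (‖k s‖ * w s) + C * Lᶜ.indicator (fun s => ‖k s‖ * w s) s := by
      filter_upwards [hbound t, hsmall] with s hs1 hs2
      rw [norm_mul, Complex.norm_real, Real.norm_of_nonneg (hw_pos t).le]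
      refine (hshift s t).trans ?_
      by_cases hs : s ∈ L
      · rw [Set.indicator_of_notMem (Set.notMem_compl_iff.2 hs), mul_zero, add_zero]
        refine mul_le_mul_of_nonneg_right (hs2 ?_) (hpos s)
        -- For `s ∈ L`, a value `τ(s)⁻¹τ(t) = τ(n)` with `n ∈ K` would put `τ(t)` in `τ(LK)`.
        rintro ⟨n, hn, hne⟩
        refine ht ⟨s * n, ⟨(s, n), ⟨hs, hn⟩, rfl⟩, ?_⟩
        rw [map_mul, hne, mul_inv_cancel_left]
      · rw [Set.indicator_of_mem (Set.mem_compl hs)]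
        have h1 : 0 ≤ ε / (2 * (M + 1)) * (‖k s‖ * w s) := mul_nonneg (by positivity) (hpos s)
        have h2 := mul_le_mul_of_nonneg_right hs1 (hpos s)
        linarith
    have hint := norm_integral_le_of_norm_le
      ((hkw.const_mul _).add ((hkw.indicator hLc).const_mul C)) hle
    rw [integral_mul_const] at hint
    refine hint.trans_lt ?_
    simp only [Pi.add_apply]
    rw [integral_add (hkw.const_mul _) ((hkw.indicator hLc).const_mul C), integral_const_mul,
      integral_const_mul, integral_indicator hLc, ← hM]
    have h1 : ε / (2 * (M + 1)) * M ≤ ε / 2 := by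
      rw [div_mul_eq_mul_div, div_le_div_iff₀ (by positivity) two_pos]
      nlinarith
    have h2 : C * ∫ s in Lᶜ, ‖k s‖ * w s ∂μ < ε / 2 := by
      have h0 : 0 ≤ ∫ s in Lᶜ, ‖k s‖ * w s ∂μ := integral_nonneg hpos
      have h3 := (lt_div_iff₀ (by positivity)).1 hLε
      nlinarith
    linarith
  refine ⟨hconv, fun ε hε => ?_, fun hcancel ε hε => ?_⟩
  · obtain ⟨K, hK, hKε⟩ := key ε hε
    refine ⟨K, hK, ?_⟩
    filter_upwards [measure_eq_zero_iff_ae_notMem.1 (measure_preimage_image_tau_sdiff hμ0 hμ hK)]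
      with t ht htK
    rw [sub_zero]
    exact hKε t fun h => ht ⟨h, htK⟩
  · obtain ⟨K, hK, hKε⟩ := key ε hε
    refine ⟨K, hK, fun t htK => ?_⟩
    rw [sub_zero]
    refine hKε t ?_
    rintro ⟨s, hs, hst⟩
    obtain ⟨u, hu⟩ := exists_mul_eq_mul_of_tau_eq hst
    rw [mul_left_cancel hu] at hs
    exact htK hs
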